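/- All graphs are simple and undirected. The hypercube $\mathcal H(X)$ on a set $X$ is the graph whose vertices are the finite subsets of $X$, two of them being adjacent iff their symmetric difference is a singleton. A partial cube is a graph that can be isometrically embedded (with respect to the shortest path distance) into some hypercube $\mathcal H(X)$; its isometric dimension $\dim_I$ is the minimum possible cardinality of such a set $X$. For an edge $xy$ of a connected graph $G$ with distance function $d$ let $W_{xy}=\{w : d(w,x)<d(w,y)\}$; Djoković's relation $\theta$ on the edges of $G$ is defined by: $xy\,\theta\,f$ iff $f$ joins a vertex of $W_{xy}$ with a vertex of $W_{yx}$. **Theorem 7.5.** Let $G_1=(V_1,E_1)$ and $G_2=(V_2,E_2)$ be finite partial cubes, let $a_1b_1\in E_1$ and $a_2b_2\in E_2$, and let $\psi$ be an isomorphism from the subgraph $(\{a_1,b_1\},\{a_1b_1\})$ of $G_1$ onto the subgraph $(\{a_2,b_2\},\{a_2b_2\})$ of $G_2$. Let $G=(V,E)$ be the graph obtained by edge-pasting $G_1$ and $G_2$: $V$ is the quotient of the disjoint union of $V_1$ and $V_2$ by the equivalence relation that identifies $a_1$ with $\psi(a_1)$, $b_1$ with $\psi(b_1)$, and nothing else,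 and $E$ consists of the images of the edges of $G_1$ and $G_2$. Then $G$ is a partial cube, the isometric dimensions of $G_1$, $G_2$ and $G$ are finite, and $$\dim_I(G)=\dim_I(G_1)+\dim_I(G_2)-1.$$ Moreover, Djoković's relations $\theta_1$, $\theta_2$, $\theta$ on $E_1$, $E_2$, $E$ are equivalence relations. If $C_i$ is the $\theta_i$-class of $a_ib_i$ and $E_1$, $E_2$ are identified with their images in $E$, then the $\theta$-classes are exactly the $\theta_1$-classes other than $C_1$, the $\theta_2$-classes other than $C_2$, and the set $C_1\cup C_2$, which is the class of the glued edge. -/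

import Mathlib

namespace SimpleGraph

universe u v

/-- The hypercube on a set `X`: the vertices are the finite subsets of `X`, and `P`, `Q` are
adjacent iff their symmetric difference is a singleton. -/
def hypercube (X : Type u) : SimpleGraph (Finset X) where
  Adj P Q := ∃ x : X, symmDiff (P : Set X) (Q : Set X) = {x}
  symm := ⟨fun P Q ⟨x, hx⟩ => ⟨x, by rw [symmDiff_comm, hx]⟩⟩
  loopless := ⟨fun P ⟨x, hx⟩ => by simp at hx⟩

/-- `G` can be isometrically embedded into `H`. Distances are taken in `ℕ∞`, so an isometric map is
automatically injective and preserves and reflects adjacency, and a graph that embeds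
isometrically into a connected graph is (pre)connected. -/
def IsometricallyEmbeds {V : Type u} {W : Type v} (G : SimpleGraph V) (H : SimpleGraph W) : Prop :=
  ∃ f : V → W, ∀ x y : V, H.edist (f x) (f y) = G.edist x y

/-- A partial cube: a graph that can be isometrically embedded into some hypercube. -/
def IsPartialCube {V : Type u} (G : SimpleGraph V) : Prop :=
  ∃ X : Type u, G.IsometricallyEmbeds (hypercube X)

/-- The isometric dimension: the minimum possible cardinality of a set `X` such that the graph can
be isometrically embedded into the hypercube on `X`. It is `⊤` if there is no finite such `X`. -/
noncomputable def isometricDim {V : Type u} (G : SimpleGraph V) : ℕ∞ :=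
  sInf {n : ℕ∞ | ∃ X : Type u, G.IsometricallyEmbeds (hypercube X) ∧ ENat.card X = n}

/-- The semicube `W_{ab}`: the set of vertices closer to `a` than to `b`. -/
def semicube {V : Type u} (G : SimpleGraph V) (a b : V) : Set V :=
  {w | G.dist w a < G.dist w b}

/-- Djoković's relation `θ` on the edges of `G`: `e θ f` iff `f` joins a vertex of `W_{xy}` with a
vertex of `W_{yx}`, where `e = xy`. -/
def theta {V : Type u} (G : SimpleGraph V) (e f : G.edgeSet) : Prop :=
  ∃ x y p q : V, (e : Sym2 V) = s(x, y) ∧ (f : Sym2 V) = s(p, q) ∧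
    p ∈ G.semicube x y ∧ q ∈ G.semicube y x

/-- The class of the edge `e` under `θ`, as a set of unordered pairs of vertices. -/
def thetaClass {V : Type u} (G : SimpleGraph V) (e : G.edgeSet) : Set (Sym2 V) :=
  {f | ∃ hf : f ∈ G.edgeSet, G.theta e ⟨f, hf⟩}

/-- The family of all `θ`-classes of `G`. -/
def thetaClasses {V : Type u} (G : SimpleGraph V) : Set (Set (Sym2 V)) :=
  Set.range G.thetaClass

section Pasting

variable {V₁ : Type u} {V₂ : Type v} {G₁ : SimpleGraph V₁} {G₂ : SimpleGraph V₂}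

/-- The equivalence relation on the disjoint union `V₁ ⊕ V₂` that identifies each vertex `u` of
`H₁` with the vertex `ψ u` of `H₂`, and nothing else. -/
def pastingSetoid (H₁ : G₁.Subgraph) (H₂ : G₂.Subgraph) (ψ : H₁.coe ≃g H₂.coe) :
    Setoid (V₁ ⊕ V₂) where
  r
    | .inl x, .inl y => x = y
    | .inr x, .inr y => x = y
    | .inl x, .inr y => ∃ z : H₁.verts, (z : V₁) = x ∧ (ψ z : V₂) = y
    | .inr y, .inl x => ∃ z : H₁.verts, (z : V₁) = x ∧ (ψ z : V₂) = y
  iseqv :=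
    { refl := by rintro (x | x) <;> rfl
      symm := by rintro (x | x) (y | y) h <;> first | exact h | exact Eq.symm h
      trans := by
        rintro (x | x) (y | y) (z | z) h h'
        · exact Eq.trans h h'
        · cases h; exact h'
        · obtain ⟨s, rfl, rfl⟩ := h
          obtain ⟨t, rfl, ht⟩ := h'
          exact congrArg Subtype.val (ψ.injective (Subtype.ext ht)).symm
        · cases h'; exact h
        · cases h'; exact h
        · obtain ⟨s, rfl, rfl⟩ := h
          obtain ⟨t, ht, rfl⟩ := h'
          exact congrArg (fun r => (ψ r : V₂)) (Subtype.ext ht).symm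
        · cases h; exact h'
        · exact Eq.trans h h' }

/-- The set of vertices obtained by pasting together `V₁` and `V₂` along `H₁` and `H₂`. -/
abbrev PastingVertex (H₁ : G₁.Subgraph) (H₂ : G₂.Subgraph) (ψ : H₁.coe ≃g H₂.coe) :
    Type (max u v) :=
  Quotient (pastingSetoid H₁ H₂ ψ)

/-- The canonical map from the vertices of `G₁` to those of the pasting. -/
def pastingInl (H₁ : G₁.Subgraph) (H₂ : G₂.Subgraph) (ψ : H₁.coe ≃g H₂.coe) (x : V₁) :
    PastingVertex H₁ H₂ ψ :=
  Quotient.mk (pastingSetoid H₁ H₂ ψ) (Sum.inl x)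

/-- The canonical map from the vertices of `G₂` to those of the pasting. -/
def pastingInr (H₁ : G₁.Subgraph) (H₂ : G₂.Subgraph) (ψ : H₁.coe ≃g H₂.coe) (x : V₂) :
    PastingVertex H₁ H₂ ψ :=
  Quotient.mk (pastingSetoid H₁ H₂ ψ) (Sum.inr x)

/-- The graph obtained by pasting together `G₁` and `G₂` along the isomorphic subgraphs `H₁` and
`H₂`: its edges are the images of the edges of `G₁` and of the edges of `G₂`. -/
def pasting (H₁ : G₁.Subgraph) (H₂ : G₂.Subgraph) (ψ : H₁.coe ≃g H₂.coe) :
    SimpleGraph (PastingVertex H₁ H₂ ψ) where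
  Adj p q :=
    (∃ x y : V₁, G₁.Adj x y ∧ pastingInl H₁ H₂ ψ x = p ∧ pastingInl H₁ H₂ ψ y = q) ∨
    (∃ x y : V₂, G₂.Adj x y ∧ pastingInr H₁ H₂ ψ x = p ∧ pastingInr H₁ H₂ ψ y = q)
  symm := ⟨by
    rintro p q (⟨x, y, h, hp, hq⟩ | ⟨x, y, h, hp, hq⟩)
    · exact Or.inl ⟨y, x, h.symm, hq, hp⟩
    · exact Or.inr ⟨y, x, h.symm, hq, hp⟩⟩
  loopless := ⟨by
    rintro p (⟨x, y, h, hp, hq⟩ | ⟨x, y, h, hp, hq⟩)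
    · have e : x = y := Quotient.exact (s := pastingSetoid H₁ H₂ ψ) (hp.trans hq.symm)
      exact h.ne e
    · have e : x = y := Quotient.exact (s := pastingSetoid H₁ H₂ ψ) (hp.trans hq.symm)
      exact h.ne e⟩

end Pasting

end SimpleGraph

/-!
A partial cube is handled through a labelling of its vertices by finite sets of coordinates in which
distance is the cardinality of the symmetric difference. The two ends of an edge are separated by
exactly one coordinate, and the semicube `W_{xy}` of an edge `xy` separated by `t` consists of the
vertices that agree with `x` at `t` (`IsCubeLabelling.mem_semicube_iff`). So two edges are in
relation `θ` iff they are separated by the same coordinate: `θ` is an equivalence relation, and its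
classes are the nonempty *cuts*, the sets of edges separated by one coordinate
(`IsCubeLabelling.thetaClasses_eq`). Coordinates that separate no edge can be discarded and the
others cannot, so the isometric dimension is the number of `θ`-classes
(`IsPartialCube.isometricDim_eq`).

For the pasting, the labellings of the two parts are translated so that `a₁` and the vertex
identified with it have the empty label. The coordinates `c₁` and `c₂` of the glued edge are then
identified and all others are kept apart. The two labellings agree on the glued edge and so define a
labelling of the pasting. It is isometric (`IsEdgePasting.isCubeLabelling`): a pair of vertices in
different parts is joined by a path through the end of the glued edge that agrees at the common
coordinate with one of them, and along this path no coordinate changes twice. The cuts of this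
labelling are the cuts of the parts, with those of `c₁` and `c₂` united
(`IsEdgePasting.isPartialCube_and_thetaClasses`); counting them gives the dimension formula.
-/

namespace SimpleGraph

open scoped symmDiff

universe u v w

/-! ### Isometric set labellings -/

/-- A labelling of the vertices of `G` by finite subsets of `X` in which the distance of two
vertices is the cardinality of the symmetric difference of their labels. This is an isometric
embedding of `G` into the hypercube on `X`, with finite sets in `Set X` in place of `Finset X`. -/
structure IsCubeLabelling {V : Type u} {X : Type v} (G : SimpleGraph V) (f : V → Set X) :
    Prop where
  finite : ∀ x, (f x).Finite
  encard_symmDiff : ∀ x y, (f x ∆ f y).encard = G.edist x y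

/-- The edges of `G` whose ends are separated by the coordinate `t` of the labelling `f`. -/
def labelCut {V : Type u} {X : Type v} (G : SimpleGraph V) (f : V → Set X) (t : X) :
    Set (Sym2 V) :=
  {e | e ∈ G.edgeSet ∧ ∃ x y, e = s(x, y) ∧ t ∈ f x ∧ t ∉ f y}

section

variable {V : Type u} {X : Type v} {G : SimpleGraph V} {f : V → Set X}

lemma encard_symmDiff_le_edist (h : ∀ x y, G.Adj x y → (f x ∆ f y).encard ≤ 1) (x y : V) :
    (f x ∆ f y).encard ≤ G.edist x y := by
  refine le_iInf fun p => ?_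
  induction p with
  | nil => simp
  | @cons a b c hab p ih =>
    calc (f a ∆ f c).encard ≤ (f a ∆ f b ∪ f b ∆ f c).encard :=
          Set.encard_le_encard (symmDiff_triangle _ _ _)
      _ ≤ (f a ∆ f b).encard + (f b ∆ f c).encard := Set.encard_union_le _ _
      _ ≤ 1 + p.length := add_le_add (h a b hab) ih
      _ = _ := by rw [Walk.length_cons]; push_cast; rw [add_comm]

lemma hypercube_edist_symmDiff_le [DecidableEq X] (P S : Finset X) :
    (hypercube X).edist P (P ∆ S) ≤ S.card := by
  induction S using Finset.induction_on with
  | empty => simp [← Finset.bot_eq_empty]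
  | @insert a S ha ih =>
    have hadj : (hypercube X).Adj (P ∆ S) (P ∆ insert a S) := by
      refine ⟨a, ?_⟩
      ext t
      by_cases hta : t = a
      · subst hta; simp [Set.mem_symmDiff, ha]; tauto
      · simp [Set.mem_symmDiff, hta]; tauto
    calc _ ≤ (hypercube X).edist P (P ∆ S) + (hypercube X).edist (P ∆ S) (P ∆ insert a S) :=
          SimpleGraph.edist_triangle
      _ ≤ S.card + 1 := add_le_add ih (edist_eq_one_iff_adj.2 hadj).le
      _ = _ := by rw [Finset.card_insert_of_notMem ha]; norm_cast

lemma hypercube_edist (P Q : Finset X) :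
    (hypercube X).edist P Q = ((P : Set X) ∆ (Q : Set X)).encard := by
  classical
  apply le_antisymm
  · have := hypercube_edist_symmDiff_le P (P ∆ Q)
    rwa [symmDiff_symmDiff_cancel_left, ← Set.encard_coe_eq_coe_finsetCard,
      Finset.coe_symmDiff] at this
  · refine encard_symmDiff_le_edist (G := hypercube X) (f := fun P : Finset X => (P : Set X))
      ?_ P Q
    rintro P Q ⟨t, ht⟩
    simp [ht]

lemma isometricallyEmbeds_hypercube_iff :
    G.IsometricallyEmbeds (hypercube X) ↔ ∃ f : V → Set X, G.IsCubeLabelling f := by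
  constructor
  · rintro ⟨f, hf⟩
    exact ⟨fun x => f x, fun x => (f x).finite_toSet, fun x y => by rw [← hf, hypercube_edist]⟩
  · rintro ⟨f, hf⟩
    exact ⟨fun x => (hf.finite x).toFinset, fun x y => by
      simp [hypercube_edist, hf.encard_symmDiff]⟩

namespace IsCubeLabelling

lemma preconnected (hf : G.IsCubeLabelling f) : G.Preconnected := fun x y => by
  rw [← edist_ne_top_iff_reachable, ← hf.encard_symmDiff, Set.encard_ne_top_iff]
  exact ((hf.finite x).union (hf.finite y)).subset Set.symmDiff_subset_union

lemma dist_eq (hf : G.IsCubeLabelling f) (x y : V) : G.dist x y = (f x ∆ f y).ncard := by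
  rw [Set.ncard_def, hf.encard_symmDiff]; rfl

lemma exists_symmDiff_eq_singleton (hf : G.IsCubeLabelling f) {x y : V} (h : G.Adj x y) :
    ∃ t, f x ∆ f y = {t} := by
  rw [← Set.encard_eq_one, hf.encard_symmDiff, edist_eq_one_iff_adj]
  exact h

/-- Translating a labelling by the label of a vertex. -/
lemma translate (hf : G.IsCubeLabelling f) (a : V) :
    G.IsCubeLabelling (fun x => f x ∆ f a) where
  finite x := ((hf.finite x).union (hf.finite a)).subset Set.symmDiff_subset_union
  encard_symmDiff x y := by
    rw [symmDiff_symmDiff_symmDiff_comm, symmDiff_self, symmDiff_bot, hf.encard_symmDiff]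

/-- For an edge `xy` separated by the coordinate `t`, the semicube `W_{xy}` consists of the
vertices whose label agrees with that of `x` at `t`. -/
lemma mem_semicube_iff (hf : G.IsCubeLabelling f) {x y : V} (h : G.Adj x y) {t : X}
    (ht : t ∈ f x ∆ f y) (w : V) : w ∈ G.semicube x y ↔ (t ∈ f w ↔ t ∈ f x) := by
  obtain ⟨t', ht'⟩ := hf.exists_symmDiff_eq_singleton h
  obtain rfl : t = t' := by rwa [ht'] at ht
  have hw : f w ∆ f y = (f w ∆ f x) ∆ {t} := by
    rw [← ht', symmDiff_assoc, symmDiff_symmDiff_cancel_left]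
  have hfin : (f w ∆ f x).Finite := ((hf.translate x).finite w)
  change G.dist w x < G.dist w y ↔ _
  rw [hf.dist_eq, hf.dist_eq, hw]
  by_cases hS : t ∈ f w ∆ f x
  · have e : (f w ∆ f x) ∆ {t} = (f w ∆ f x) \ {t} := by
      ext s
      by_cases hs : s = t
      · subst hs; simp [Set.mem_symmDiff] at hS ⊢; tauto
      · simp [Set.mem_symmDiff, hs]
    rw [e]
    have := Set.ncard_sdiff_singleton_lt_of_mem hS hfin
    rw [Set.mem_symmDiff] at hS
    constructor
    · intro; omega
    · intro; tauto
  · have e : (f w ∆ f x) ∆ {t} = insert t (f w ∆ f x) := by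
      ext s
      by_cases hs : s = t
      · subst hs; simp [Set.mem_symmDiff] at hS ⊢; tauto
      · simp [Set.mem_symmDiff, hs]
    rw [e, Set.ncard_insert_of_notMem hS hfin]
    rw [Set.mem_symmDiff] at hS
    constructor
    · intro; tauto
    · intro; omega

end IsCubeLabelling

/-! ### The classes of Djoković's relation -/

lemma mk_mem_labelCut {x y : V} {t : X} :
    s(x, y) ∈ G.labelCut f t ↔ G.Adj x y ∧ t ∈ f x ∆ f y := by
  constructor
  · rintro ⟨h, p, q, e, hp, hq⟩
    refine ⟨h, ?_⟩
    rcases Sym2.eq_iff.1 e with ⟨rfl, rfl⟩ | ⟨rfl, rfl⟩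
    · exact Or.inl ⟨hp, hq⟩
    · exact Or.inr ⟨hp, hq⟩
  · rintro ⟨h, ⟨hp, hq⟩ | ⟨hp, hq⟩⟩
    · exact ⟨h, x, y, rfl, hp, hq⟩
    · exact ⟨h, y, x, Sym2.eq_swap, hp, hq⟩

namespace IsCubeLabelling

lemma exists_mem_labelCut (hf : G.IsCubeLabelling f) {e : Sym2 V} (he : e ∈ G.edgeSet) :
    ∃ t, e ∈ G.labelCut f t := by
  induction e with | _ x y
  obtain ⟨t, ht⟩ := hf.exists_symmDiff_eq_singleton he
  exact ⟨t, mk_mem_labelCut.2 ⟨he, by simp [ht]⟩⟩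

lemma eq_of_mem_labelCut (hf : G.IsCubeLabelling f) {e : Sym2 V} {s t : X}
    (hs : e ∈ G.labelCut f s) (ht : e ∈ G.labelCut f t) : s = t := by
  induction e with | _ x y
  rw [mk_mem_labelCut] at hs ht
  obtain ⟨r, hr⟩ := hf.exists_symmDiff_eq_singleton hs.1
  rw [hr] at hs ht
  exact hs.2.trans ht.2.symm

/-- The class of an edge consists of the edges separated by the same coordinate. -/
lemma theta_iff (hf : G.IsCubeLabelling f) {e e' : G.edgeSet} {t : X}
    (he : (e : Sym2 V) ∈ G.labelCut f t) :
    G.theta e e' ↔ (e' : Sym2 V) ∈ G.labelCut f t := by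
  constructor
  · rintro ⟨x, y, p, q, h, h', hp, hq⟩
    rw [h, mk_mem_labelCut] at he
    have hadj : G.Adj p q := by have := e'.2; rwa [h'] at this
    rw [hf.mem_semicube_iff he.1 he.2] at hp
    rw [hf.mem_semicube_iff he.1.symm (by rw [symmDiff_comm]; exact he.2)] at hq
    rw [h', mk_mem_labelCut]
    refine ⟨hadj, ?_⟩
    have := he.2
    rw [Set.mem_symmDiff] at this ⊢
    tauto
  · rintro ⟨-, p, q, h', hp, hq⟩
    obtain ⟨-, x, y, h, hx, hy⟩ := id he
    rw [h, mk_mem_labelCut] at he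
    refine ⟨x, y, p, q, h, h', ?_, ?_⟩
    · rw [hf.mem_semicube_iff he.1 he.2]; tauto
    · rw [hf.mem_semicube_iff he.1.symm (by rw [symmDiff_comm]; exact he.2)]; tauto

lemma equivalence_theta (hf : G.IsCubeLabelling f) : Equivalence G.theta where
  refl e := by
    obtain ⟨t, ht⟩ := hf.exists_mem_labelCut e.2
    exact (hf.theta_iff ht).2 ht
  symm {e e'} h := by
    obtain ⟨t, ht⟩ := hf.exists_mem_labelCut e.2
    exact (hf.theta_iff ((hf.theta_iff ht).1 h)).2 ht
  trans {e e' e''} h h' := by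
    obtain ⟨t, ht⟩ := hf.exists_mem_labelCut e.2
    exact (hf.theta_iff ht).2 ((hf.theta_iff ((hf.theta_iff ht).1 h)).1 h')

lemma thetaClass_eq (hf : G.IsCubeLabelling f) {e : G.edgeSet} {t : X}
    (he : (e : Sym2 V) ∈ G.labelCut f t) : G.thetaClass e = G.labelCut f t := by
  ext e'
  constructor
  · rintro ⟨h, h'⟩
    exact (hf.theta_iff he).1 h'
  · intro h
    exact ⟨h.1, (hf.theta_iff he).2 h⟩

lemma thetaClasses_eq (hf : G.IsCubeLabelling f) :
    G.thetaClasses = G.labelCut f '' {t | (G.labelCut f t).Nonempty} := by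
  ext C
  constructor
  · rintro ⟨e, rfl⟩
    obtain ⟨t, ht⟩ := hf.exists_mem_labelCut e.2
    exact ⟨t, ⟨e, ht⟩, (hf.thetaClass_eq ht).symm⟩
  · rintro ⟨t, ⟨e, he⟩, rfl⟩
    exact ⟨⟨e, he.1⟩, hf.thetaClass_eq he⟩

lemma injOn_labelCut (hf : G.IsCubeLabelling f) :
    Set.InjOn (G.labelCut f) {t | (G.labelCut f t).Nonempty} := by
  rintro s ⟨e, he⟩ t - hst
  exact hf.eq_of_mem_labelCut he (hst ▸ he)

lemma encard_thetaClasses (hf : G.IsCubeLabelling f) :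
    G.thetaClasses.encard = {t | (G.labelCut f t).Nonempty}.encard := by
  rw [hf.thetaClasses_eq, hf.injOn_labelCut.encard_image]

/-! ### The isometric dimension -/

/-- Along a walk only coordinates that separate the ends of some edge change. -/
lemma symmDiff_subset_labelCut_nonempty (hf : G.IsCubeLabelling f) (x y : V) :
    f x ∆ f y ⊆ {t | (G.labelCut f t).Nonempty} := by
  obtain ⟨p⟩ := hf.preconnected x y
  induction p with
  | nil => simp
  | @cons a b c hab p ih =>
    refine (symmDiff_triangle (f a) (f b) (f c)).trans (Set.union_subset ?_ ih)
    exact fun t ht => ⟨s(a, b), mk_mem_labelCut.2 ⟨hab, ht⟩⟩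

/-- Discarding the coordinates that separate no edge. -/
lemma restrict (hf : G.IsCubeLabelling f) :
    G.IsCubeLabelling (fun x =>
      (Subtype.val ⁻¹' f x : Set {t // (G.labelCut f t).Nonempty})) where
  finite x := (hf.finite x).preimage Subtype.val_injective.injOn
  encard_symmDiff x y := by
    rw [← Set.preimage_symmDiff, Set.encard_preimage_of_injective_subset_range
      Subtype.val_injective, hf.encard_symmDiff]
    simpa using hf.symmDiff_subset_labelCut_nonempty x y

end IsCubeLabelling

end

/-- The isometric dimension of a partial cube is its number of `θ`-classes. -/
lemma IsPartialCube.isometricDim_eq {V : Type u} {G : SimpleGraph V} (hG : G.IsPartialCube) :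
    G.isometricDim = G.thetaClasses.encard := by
  apply le_antisymm
  · obtain ⟨X, hX⟩ := hG
    obtain ⟨f, hf⟩ := isometricallyEmbeds_hypercube_iff.1 hX
    rw [hf.encard_thetaClasses]
    exact sInf_le ⟨_, isometricallyEmbeds_hypercube_iff.2 ⟨_, hf.restrict⟩, rfl⟩
  · refine le_sInf ?_
    rintro _ ⟨X, hX, rfl⟩
    obtain ⟨f, hf⟩ := isometricallyEmbeds_hypercube_iff.1 hX
    rw [hf.encard_thetaClasses, ← Set.encard_univ]
    exact Set.encard_le_encard (Set.subset_univ _)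

lemma isometricDim_ne_top {V : Type u} [Finite V] {G : SimpleGraph V} (hG : G.IsPartialCube) :
    G.isometricDim ≠ ⊤ := by
  rw [hG.isometricDim_eq, Set.encard_ne_top_iff]
  exact Set.finite_range _

/-! ### Gluing two labellings along an edge -/

open Classical in
/-- The embedding of the coordinates `X₂` into `X₁ ⊕ X₂` that identifies `c₂` with `c₁` and leaves
the other coordinates of `X₂` apart from those of `X₁`. -/
noncomputable def glueCoord {X₁ : Type u} {X₂ : Type v} (c₁ : X₁) (c₂ : X₂) (t : X₂) : X₁ ⊕ X₂ :=
  if t = c₂ then Sum.inl c₁ else Sum.inr t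

section

variable {X₁ : Type u} {X₂ : Type v} {c₁ : X₁} {c₂ : X₂}

lemma glueCoord_injective : Function.Injective (glueCoord c₁ c₂) := by
  intro s t h
  unfold glueCoord at h
  split_ifs at h <;> simp_all

lemma inl_mem_image_glueCoord {B : Set X₂} {s : X₁} :
    Sum.inl s ∈ glueCoord c₁ c₂ '' B ↔ s = c₁ ∧ c₂ ∈ B := by
  constructor
  · rintro ⟨t, ht, h⟩
    unfold glueCoord at h
    split_ifs at h
    all_goals simp_all
  · rintro ⟨rfl, h⟩
    exact ⟨c₂, h, by simp [glueCoord]⟩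

lemma inr_mem_image_glueCoord {B : Set X₂} {s : X₂} :
    Sum.inr s ∈ glueCoord c₁ c₂ '' B ↔ s ≠ c₂ ∧ s ∈ B := by
  constructor
  · rintro ⟨t, ht, h⟩
    unfold glueCoord at h
    split_ifs at h
    all_goals simp_all
  · rintro ⟨hs, h⟩
    exact ⟨s, h, by simp [glueCoord, hs]⟩

lemma inr_notMem_image_inl {A : Set X₁} {s : X₂} : (Sum.inr s : X₁ ⊕ X₂) ∉ Sum.inl '' A := by
  simp

lemma inl_symmDiff_glueCoord_of_notMem (A : Set X₁) {B : Set X₂} (h : c₂ ∉ B) :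
    ((Sum.inl '' A) ∆ (glueCoord c₁ c₂ '' B)).encard = A.encard + B.encard := by
  have hd : Disjoint (Sum.inl '' A) (glueCoord c₁ c₂ '' B) := by
    rw [Set.disjoint_left]
    rintro _ ⟨s, -, rfl⟩ hs
    exact h (inl_mem_image_glueCoord.1 hs).2
  rw [hd.symmDiff_eq_sup]
  change (_ ∪ _ : Set _).encard = _
  rw [Set.encard_union_eq hd, Sum.inl_injective.encard_image, glueCoord_injective.encard_image]

lemma inl_symmDiff_glueCoord_of_mem (A : Set X₁) {B : Set X₂} (h : c₂ ∈ B) :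
    ((Sum.inl '' A) ∆ (glueCoord c₁ c₂ '' B)).encard =
      (A ∆ {c₁}).encard + ({c₂} ∆ B).encard := by
  have hB : c₂ ∉ {c₂} ∆ B := by simp [Set.mem_symmDiff, h]
  rw [← inl_symmDiff_glueCoord_of_notMem (c₁ := c₁) _ hB]
  congr 1
  ext (s | s)
  · simp only [Set.mem_symmDiff, inl_mem_image_glueCoord, Sum.inl_injective.mem_set_image,
      Set.mem_singleton_iff]
    tauto
  · simp only [Set.mem_symmDiff, inr_mem_image_glueCoord, Set.mem_singleton_iff]
    simp
    tauto

end

/-! ### Isometric labellings of edge-pastings -/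

/-- `G` arises from `G₁` and `G₂` by pasting the edge `a₁b₁` onto the edge `a₂b₂`, with `a₁`
identified with `a₂` and `b₁` with `b₂`; the maps `p₁` and `p₂` are the inclusions of the two
parts. -/
structure IsEdgePasting {V₁ : Type u} {V₂ : Type v} {W : Type w} (G₁ : SimpleGraph V₁)
    (G₂ : SimpleGraph V₂) (G : SimpleGraph W) (p₁ : V₁ → W) (p₂ : V₂ → W) (a₁ b₁ : V₁)
    (a₂ b₂ : V₂) : Prop where
  adj₁ : G₁.Adj a₁ b₁
  adj₂ : G₂.Adj a₂ b₂
  surj : ∀ q, (∃ x, p₁ x = q) ∨ ∃ y, p₂ y = q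
  inj₁ : Function.Injective p₁
  inj₂ : Function.Injective p₂
  eq_iff : ∀ x y, p₁ x = p₂ y ↔ x = a₁ ∧ y = a₂ ∨ x = b₁ ∧ y = b₂
  adj_iff : ∀ p q, G.Adj p q ↔
    (∃ x y, G₁.Adj x y ∧ p₁ x = p ∧ p₁ y = q) ∨ ∃ x y, G₂.Adj x y ∧ p₂ x = p ∧ p₂ y = q

lemma edist_le_of_map_adj {V : Type u} {W : Type v} {G : SimpleGraph V} {H : SimpleGraph W}
    {p : V → W} (h : ∀ x y, G.Adj x y → H.Adj (p x) (p y)) (x y : V) :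
    H.edist (p x) (p y) ≤ G.edist x y := by
  refine le_iInf fun q => ?_
  let φ : G →g H := ⟨p, fun {x y} => h x y⟩
  have := edist_le (q.map φ)
  rwa [Walk.length_map] at this

/-- After a translation, a given edge joins the empty label to a singleton. -/
lemma IsPartialCube.exists_normalized_labelling {V : Type u} {G : SimpleGraph V}
    (hG : G.IsPartialCube) {a b : V} (hab : G.Adj a b) :
    ∃ (X : Type u) (f : V → Set X) (c : X), G.IsCubeLabelling f ∧ f a = ∅ ∧ f b = {c} := by
  obtain ⟨X, hX⟩ := hG
  obtain ⟨f, hf⟩ := isometricallyEmbeds_hypercube_iff.1 hX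
  obtain ⟨c, hc⟩ := hf.exists_symmDiff_eq_singleton hab.symm
  exact ⟨X, _, c, hf.translate a, symmDiff_self _, hc⟩

lemma IsCubeLabelling.thetaClasses_sdiff {V : Type u} {X : Type v} {G : SimpleGraph V}
    {f : V → Set X} (hf : G.IsCubeLabelling f) {e : Sym2 V} {c : X} (he : e ∈ G.labelCut f c) :
    G.thetaClasses \ {G.labelCut f c} =
      G.labelCut f '' ({t | (G.labelCut f t).Nonempty} \ {c}) := by
  have hc : c ∈ {t | (G.labelCut f t).Nonempty} := ⟨e, he⟩
  rw [hf.thetaClasses_eq, hf.injOn_labelCut.image_sdiff_subset (Set.singleton_subset_iff.2 hc),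
    Set.image_singleton]

namespace IsEdgePasting

section

variable {V₁ : Type u} {V₂ : Type v} {W : Type w} {G₁ : SimpleGraph V₁} {G₂ : SimpleGraph V₂}
  {G : SimpleGraph W} {p₁ : V₁ → W} {p₂ : V₂ → W} {a₁ b₁ : V₁} {a₂ b₂ : V₂}

lemma map_adj₁ (h : IsEdgePasting G₁ G₂ G p₁ p₂ a₁ b₁ a₂ b₂) (x y : V₁) (hxy : G₁.Adj x y) :
    G.Adj (p₁ x) (p₁ y) :=
  (h.adj_iff _ _).2 (Or.inl ⟨x, y, hxy, rfl, rfl⟩)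

lemma map_adj₂ (h : IsEdgePasting G₁ G₂ G p₁ p₂ a₁ b₁ a₂ b₂) (x y : V₂) (hxy : G₂.Adj x y) :
    G.Adj (p₂ x) (p₂ y) :=
  (h.adj_iff _ _).2 (Or.inr ⟨x, y, hxy, rfl, rfl⟩)

/-- Maps on the two parts that agree on the glued edge extend to the pasting. -/
lemma exists_extend {Y : Type*} (h : IsEdgePasting G₁ G₂ G p₁ p₂ a₁ b₁ a₂ b₂) (g₁ : V₁ → Y)
    (g₂ : V₂ → Y) (ha : g₁ a₁ = g₂ a₂) (hb : g₁ b₁ = g₂ b₂) :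
    ∃ F : W → Y, (∀ x, F (p₁ x) = g₁ x) ∧ ∀ y, F (p₂ y) = g₂ y := by
  have key : ∀ q, ∃ r, (∀ x, p₁ x = q → g₁ x = r) ∧ ∀ y, p₂ y = q → g₂ y = r := by
    have hc : ∀ x y, p₁ x = p₂ y → g₁ x = g₂ y := fun x y e => by
      rcases (h.eq_iff x y).1 e with ⟨rfl, rfl⟩ | ⟨rfl, rfl⟩ <;> assumption
    intro q
    rcases h.surj q with ⟨x, rfl⟩ | ⟨y, rfl⟩
    · exact ⟨g₁ x, fun x' e => by rw [h.inj₁ e], fun y e => (hc x y e.symm).symm⟩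
    · exact ⟨g₂ y, fun x e => hc x y e, fun y' e => by rw [h.inj₂ e]⟩
  choose F hF using key
  exact ⟨F, fun x => ((hF _).1 x rfl).symm, fun y => ((hF _).2 y rfl).symm⟩

/-- The edges of the pasting separated by a coordinate are those of the two parts. -/
lemma labelCut_eq {X : Type*} (h : IsEdgePasting G₁ G₂ G p₁ p₂ a₁ b₁ a₂ b₂) (F : W → Set X)
    (t : X) : G.labelCut F t =
      Sym2.map p₁ '' G₁.labelCut (fun x => F (p₁ x)) t ∪
        Sym2.map p₂ '' G₂.labelCut (fun y => F (p₂ y)) t := by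
  ext e
  constructor
  · intro he
    induction e with | _ p q
    rw [mk_mem_labelCut] at he
    rcases (h.adj_iff _ _).1 he.1 with ⟨x, y, hxy, rfl, rfl⟩ | ⟨x, y, hxy, rfl, rfl⟩
    · exact Or.inl ⟨s(x, y), mk_mem_labelCut.2 ⟨hxy, he.2⟩, rfl⟩
    · exact Or.inr ⟨s(x, y), mk_mem_labelCut.2 ⟨hxy, he.2⟩, rfl⟩
  · rintro (⟨e, he, rfl⟩ | ⟨e, he, rfl⟩) <;> induction e with | _ x y <;>
      rw [mk_mem_labelCut] at he <;> refine mk_mem_labelCut.2 ⟨?_, he.2⟩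
    · exact h.map_adj₁ _ _ he.1
    · exact h.map_adj₂ _ _ he.1

end

section

variable {V₁ : Type u} {V₂ : Type v} {W : Type w} {G₁ : SimpleGraph V₁} {G₂ : SimpleGraph V₂}
  {G : SimpleGraph W} {p₁ : V₁ → W} {p₂ : V₂ → W} {a₁ b₁ : V₁} {a₂ b₂ : V₂}
  {X₁ : Type u} {X₂ : Type v} {f₁ : V₁ → Set X₁} {f₂ : V₂ → Set X₂} {c₁ : X₁} {c₂ : X₂}
  {F : W → Set (X₁ ⊕ X₂)}

/-- Gluing labellings of the two parts at the coordinate of the glued edge labels the pasting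
isometrically: a path between the two parts passes through the end of the glued edge whose label
agrees at that coordinate with the label of its last vertex. -/
lemma isCubeLabelling (h : IsEdgePasting G₁ G₂ G p₁ p₂ a₁ b₁ a₂ b₂)
    (hf₁ : G₁.IsCubeLabelling f₁) (hf₂ : G₂.IsCubeLabelling f₂)
    (ha₁ : f₁ a₁ = ∅) (ha₂ : f₂ a₂ = ∅) (hb₁ : f₁ b₁ = {c₁}) (hb₂ : f₂ b₂ = {c₂})
    (hF₁ : ∀ x, F (p₁ x) = Sum.inl '' f₁ x) (hF₂ : ∀ y, F (p₂ y) = glueCoord c₁ c₂ '' f₂ y) :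
    G.IsCubeLabelling F := by
  have e₁ : ∀ x y, (F (p₁ x) ∆ F (p₁ y)).encard = G₁.edist x y := fun x y => by
    rw [hF₁, hF₁, ← Set.image_symmDiff Sum.inl_injective, Sum.inl_injective.encard_image,
      hf₁.encard_symmDiff]
  have e₂ : ∀ x y, (F (p₂ x) ∆ F (p₂ y)).encard = G₂.edist x y := fun x y => by
    rw [hF₂, hF₂, ← Set.image_symmDiff glueCoord_injective, glueCoord_injective.encard_image,
      hf₂.encard_symmDiff]
  have cross : ∀ x y, G.edist (p₁ x) (p₂ y) ≤ (F (p₁ x) ∆ F (p₂ y)).encard := fun x y => by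
    have via : ∀ s₁ s₂, p₁ s₁ = p₂ s₂ → G.edist (p₁ x) (p₂ y) ≤
        (f₁ x ∆ f₁ s₁).encard + (f₂ s₂ ∆ f₂ y).encard := fun s₁ s₂ hs => by
      rw [hf₁.encard_symmDiff, hf₂.encard_symmDiff]
      calc _ ≤ G.edist (p₁ x) (p₁ s₁) + G.edist (p₁ s₁) (p₂ y) := SimpleGraph.edist_triangle
        _ ≤ _ := by
          refine add_le_add (edist_le_of_map_adj h.map_adj₁ _ _) ?_
          rw [hs]
          exact edist_le_of_map_adj h.map_adj₂ _ _
    rw [hF₁, hF₂]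
    by_cases hc : c₂ ∈ f₂ y
    · rw [inl_symmDiff_glueCoord_of_mem _ hc, ← hb₁, ← hb₂]
      exact via b₁ b₂ ((h.eq_iff _ _).2 (Or.inr ⟨rfl, rfl⟩))
    · rw [inl_symmDiff_glueCoord_of_notMem _ hc]
      have := via a₁ a₂ ((h.eq_iff _ _).2 (Or.inl ⟨rfl, rfl⟩))
      rw [ha₁, ha₂, ← Set.bot_eq_empty, ← Set.bot_eq_empty, symmDiff_bot, bot_symmDiff] at this
      exact this
  refine ⟨fun q => ?_, fun p q => le_antisymm (encard_symmDiff_le_edist ?_ p q) ?_⟩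
  · rcases h.surj q with ⟨x, rfl⟩ | ⟨y, rfl⟩
    · rw [hF₁]; exact (hf₁.finite x).image _
    · rw [hF₂]; exact (hf₂.finite y).image _
  · intro p q hpq
    rcases (h.adj_iff _ _).1 hpq with ⟨x, y, hxy, rfl, rfl⟩ | ⟨x, y, hxy, rfl, rfl⟩
    · rw [e₁]; exact (edist_eq_one_iff_adj.2 hxy).le
    · rw [e₂]; exact (edist_eq_one_iff_adj.2 hxy).le
  · rcases h.surj p with ⟨x, rfl⟩ | ⟨x, rfl⟩ <;> rcases h.surj q with ⟨y, rfl⟩ | ⟨y, rfl⟩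
    · rw [e₁]; exact edist_le_of_map_adj h.map_adj₁ _ _
    · exact cross x y
    · rw [SimpleGraph.edist_comm, symmDiff_comm]; exact cross y x
    · rw [e₂]; exact edist_le_of_map_adj h.map_adj₂ _ _

lemma labelCut_inl_of_ne (h : IsEdgePasting G₁ G₂ G p₁ p₂ a₁ b₁ a₂ b₂)
    (hF₁ : ∀ x, F (p₁ x) = Sum.inl '' f₁ x) (hF₂ : ∀ y, F (p₂ y) = glueCoord c₁ c₂ '' f₂ y)
    {s : X₁} (hs : s ≠ c₁) :
    G.labelCut F (Sum.inl s) = Sym2.map p₁ '' G₁.labelCut f₁ s := by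
  have e₂ : G₂.labelCut (fun y => F (p₂ y)) (Sum.inl s) = ∅ := by
    ext e; simp [-Set.mem_image, labelCut, hF₂, inl_mem_image_glueCoord, hs]
  rw [h.labelCut_eq, e₂]
  simp [-Set.mem_image, labelCut, hF₁, Sum.inl_injective.mem_set_image]

lemma labelCut_inl (h : IsEdgePasting G₁ G₂ G p₁ p₂ a₁ b₁ a₂ b₂)
    (hF₁ : ∀ x, F (p₁ x) = Sum.inl '' f₁ x) (hF₂ : ∀ y, F (p₂ y) = glueCoord c₁ c₂ '' f₂ y) :
    G.labelCut F (Sum.inl c₁) =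
      Sym2.map p₁ '' G₁.labelCut f₁ c₁ ∪ Sym2.map p₂ '' G₂.labelCut f₂ c₂ := by
  rw [h.labelCut_eq]
  simp [-Set.mem_image, labelCut, hF₁, hF₂, inl_mem_image_glueCoord, Sum.inl_injective.mem_set_image]

lemma labelCut_inr_of_ne (h : IsEdgePasting G₁ G₂ G p₁ p₂ a₁ b₁ a₂ b₂)
    (hF₁ : ∀ x, F (p₁ x) = Sum.inl '' f₁ x) (hF₂ : ∀ y, F (p₂ y) = glueCoord c₁ c₂ '' f₂ y)
    {s : X₂} (hs : s ≠ c₂) :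
    G.labelCut F (Sum.inr s) = Sym2.map p₂ '' G₂.labelCut f₂ s := by
  have e₁ : G₁.labelCut (fun x => F (p₁ x)) (Sum.inr s) = ∅ := by
    ext e; simp [-Set.mem_image, labelCut, hF₁, inr_notMem_image_inl]
  rw [h.labelCut_eq, e₁]
  simp [-Set.mem_image, labelCut, hF₂, inr_mem_image_glueCoord, hs]

lemma labelCut_inr (h : IsEdgePasting G₁ G₂ G p₁ p₂ a₁ b₁ a₂ b₂)
    (hF₁ : ∀ x, F (p₁ x) = Sum.inl '' f₁ x) (hF₂ : ∀ y, F (p₂ y) = glueCoord c₁ c₂ '' f₂ y) :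
    G.labelCut F (Sum.inr c₂) = ∅ := by
  rw [h.labelCut_eq]
  simp [-Set.mem_image, labelCut, hF₁, hF₂, inr_mem_image_glueCoord, inr_notMem_image_inl]

/-- The coordinates of the glued labelling that separate some edge. -/
lemma setOf_labelCut_nonempty (h : IsEdgePasting G₁ G₂ G p₁ p₂ a₁ b₁ a₂ b₂)
    (hF₁ : ∀ x, F (p₁ x) = Sum.inl '' f₁ x) (hF₂ : ∀ y, F (p₂ y) = glueCoord c₁ c₂ '' f₂ y)
    (hc₁ : (G₁.labelCut f₁ c₁).Nonempty) :
    {t | (G.labelCut F t).Nonempty} =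
      Sum.inl '' {t | (G₁.labelCut f₁ t).Nonempty} ∪
        Sum.inr '' ({t | (G₂.labelCut f₂ t).Nonempty} \ {c₂}) := by
  ext (s | s)
  · by_cases hs : s = c₁
    · subst hs
      simp [h.labelCut_inl hF₁ hF₂, hc₁]
    · simp [h.labelCut_inl_of_ne hF₁ hF₂ hs]
  · by_cases hs : s = c₂
    · subst hs
      simp [h.labelCut_inr hF₁ hF₂]
    · simp [h.labelCut_inr_of_ne hF₁ hF₂ hs, hs]

end

/-- The edge-pasting of two partial cubes is a partial cube. Its `θ`-classes are those of the two
parts, with the classes of the glued edge merged into one. -/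
theorem isPartialCube_and_thetaClasses {V₁ : Type u} {V₂ : Type v} {W : Type max u v}
    {G₁ : SimpleGraph V₁} {G₂ : SimpleGraph V₂} {G : SimpleGraph W} {p₁ : V₁ → W} {p₂ : V₂ → W}
    {a₁ b₁ : V₁} {a₂ b₂ : V₂} (h : IsEdgePasting G₁ G₂ G p₁ p₂ a₁ b₁ a₂ b₂)
    (hG₁ : G₁.IsPartialCube) (hG₂ : G₂.IsPartialCube) :
    G.IsPartialCube ∧
      G.thetaClasses.encard + 1 = G₁.thetaClasses.encard + G₂.thetaClasses.encard ∧
      G.thetaClasses =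
        (Set.image (Sym2.map p₁) '' (G₁.thetaClasses \ {G₁.thetaClass ⟨s(a₁, b₁), h.adj₁⟩})) ∪
        (Set.image (Sym2.map p₂) '' (G₂.thetaClasses \ {G₂.thetaClass ⟨s(a₂, b₂), h.adj₂⟩})) ∪
        {Sym2.map p₁ '' G₁.thetaClass ⟨s(a₁, b₁), h.adj₁⟩ ∪
          Sym2.map p₂ '' G₂.thetaClass ⟨s(a₂, b₂), h.adj₂⟩} := by
  obtain ⟨X₁, f₁, c₁, hf₁, ha₁, hb₁⟩ := hG₁.exists_normalized_labelling h.adj₁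
  obtain ⟨X₂, f₂, c₂, hf₂, ha₂, hb₂⟩ := hG₂.exists_normalized_labelling h.adj₂
  obtain ⟨F, hF₁, hF₂⟩ := h.exists_extend (fun x => (Sum.inl '' f₁ x : Set (X₁ ⊕ X₂)))
    (fun y => glueCoord c₁ c₂ '' f₂ y) (by simp [ha₁, ha₂]) (by simp [hb₁, hb₂, glueCoord])
  have hF := h.isCubeLabelling hf₁ hf₂ ha₁ ha₂ hb₁ hb₂ hF₁ hF₂
  have hm₁ : s(a₁, b₁) ∈ G₁.labelCut f₁ c₁ :=
    mk_mem_labelCut.2 ⟨h.adj₁, by simp [ha₁, hb₁, Set.mem_symmDiff]⟩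
  have hm₂ : s(a₂, b₂) ∈ G₂.labelCut f₂ c₂ :=
    mk_mem_labelCut.2 ⟨h.adj₂, by simp [ha₂, hb₂, Set.mem_symmDiff]⟩
  have hT := h.setOf_labelCut_nonempty hF₁ hF₂ ⟨_, hm₁⟩
  refine ⟨⟨X₁ ⊕ X₂, isometricallyEmbeds_hypercube_iff.2 ⟨F, hF⟩⟩, ?_, ?_⟩
  · rw [hF.encard_thetaClasses, hf₁.encard_thetaClasses, hf₂.encard_thetaClasses, hT,
      Set.encard_union_eq (by simp [Set.disjoint_left]), Sum.inl_injective.encard_image,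
      Sum.inr_injective.encard_image, add_assoc]
    congr 1
    exact Set.encard_sdiff_singleton_add_one (Set.nonempty_of_mem hm₂)
  · rw [hf₁.thetaClass_eq (e := ⟨s(a₁, b₁), h.adj₁⟩) hm₁,
      hf₂.thetaClass_eq (e := ⟨s(a₂, b₂), h.adj₂⟩) hm₂,
      hf₁.thetaClasses_sdiff hm₁, hf₂.thetaClasses_sdiff hm₂, hF.thetaClasses_eq, hT,
      ← h.labelCut_inl hF₁ hF₂]
    -- Split off the coordinate `c₁` of the glued edge from those of the first part.
    have hc₁ : insert c₁ ({t | (G₁.labelCut f₁ t).Nonempty} \ {c₁}) =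
        {t | (G₁.labelCut f₁ t).Nonempty} := Set.insert_sdiff_self_of_mem ⟨_, hm₁⟩
    nth_rw 1 [← hc₁]
    simp only [Set.image_union, Set.image_insert_eq, Set.image_image]
    rw [Set.image_congr (s := {t | (G₁.labelCut f₁ t).Nonempty} \ {c₁})
        fun t ht => h.labelCut_inl_of_ne hF₁ hF₂ ht.2,
      Set.image_congr (s := {t | (G₂.labelCut f₂ t).Nonempty} \ {c₂})
        fun t ht => h.labelCut_inr_of_ne hF₁ hF₂ ht.2,
      Set.insert_eq, Set.union_assoc, Set.union_comm]

end IsEdgePasting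

/-! ### The quotient construction -/

/-- The quotient graph is an edge-pasting. The ends of the second edge are named as the images of
`a₁` and `b₁`, since `ψ` may send `a₁` to either `a₂` or `b₂`. -/
lemma isEdgePasting_pasting {V₁ : Type*} {V₂ : Type*} {G₁ : SimpleGraph V₁}
    {G₂ : SimpleGraph V₂} {a₁ b₁ : V₁} {a₂ b₂ : V₂} (h₁ : G₁.Adj a₁ b₁) (h₂ : G₂.Adj a₂ b₂)
    (ψ : (G₁.subgraphOfAdj h₁).coe ≃g (G₂.subgraphOfAdj h₂).coe) :
    ∃ α β : V₂, s(α, β) = s(a₂, b₂) ∧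
      IsEdgePasting G₁ G₂ (pasting (G₁.subgraphOfAdj h₁) (G₂.subgraphOfAdj h₂) ψ)
        (pastingInl _ _ ψ) (pastingInr _ _ ψ) a₁ b₁ α β := by
  have ha : a₁ ∈ (G₁.subgraphOfAdj h₁).verts := by simp
  have hb : b₁ ∈ (G₁.subgraphOfAdj h₁).verts := by simp
  have hadj : (G₁.subgraphOfAdj h₁).coe.Adj ⟨a₁, ha⟩ ⟨b₁, hb⟩ := by simp
  have hψ : (G₂.subgraphOfAdj h₂).Adj (ψ ⟨a₁, ha⟩) (ψ ⟨b₁, hb⟩) := ψ.map_adj_iff.2 hadj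
  refine ⟨ψ ⟨a₁, ha⟩, ψ ⟨b₁, hb⟩, (Eq.mp (subgraphOfAdj_adj ..) hψ).symm, h₁, hψ.adj_sub, ?_, ?_, ?_,
    ?_, fun p q => Iff.rfl⟩
  · intro q
    induction q using Quotient.inductionOn with | _ z
    rcases z with x | y
    · exact Or.inl ⟨x, rfl⟩
    · exact Or.inr ⟨y, rfl⟩
  · exact fun x y h => Quotient.exact h
  · exact fun x y h => Quotient.exact h
  · intro x y
    constructor
    · intro h
      obtain ⟨⟨z, hz⟩, rfl, rfl⟩ := Quotient.exact h
      have hz' : z = a₁ ∨ z = b₁ := by simpa using hz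
      rcases hz' with rfl | rfl
      · exact Or.inl ⟨rfl, rfl⟩
      · exact Or.inr ⟨rfl, rfl⟩
    · rintro (⟨rfl, rfl⟩ | ⟨rfl, rfl⟩)
      · exact Quotient.sound ⟨⟨_, ha⟩, rfl, rfl⟩
      · exact Quotient.sound ⟨⟨_, hb⟩, rfl, rfl⟩

lemma IsPartialCube.equivalence_theta {V : Type*} {G : SimpleGraph V}
    (hG : G.IsPartialCube) : Equivalence G.theta := by
  obtain ⟨X, hX⟩ := hG
  obtain ⟨f, hf⟩ := isometricallyEmbeds_hypercube_iff.1 hX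
  exact hf.equivalence_theta

end SimpleGraph

theorem theorem7p5 {V₁ : Type*} {V₂ : Type*} [Finite V₁] [Finite V₂]
    (G₁ : SimpleGraph V₁) (G₂ : SimpleGraph V₂)
    (hG₁ : G₁.IsPartialCube) (hG₂ : G₂.IsPartialCube)
    (a₁ b₁ : V₁) (a₂ b₂ : V₂) (h₁ : G₁.Adj a₁ b₁) (h₂ : G₂.Adj a₂ b₂)
    -- `ψ` identifies the subgraph formed by the edge `a₁b₁` with the one formed by `a₂b₂`
    (ψ : (G₁.subgraphOfAdj h₁).coe ≃g (G₂.subgraphOfAdj h₂).coe) :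
    let G := SimpleGraph.pasting (G₁.subgraphOfAdj h₁) (G₂.subgraphOfAdj h₂) ψ
    let ι₁ := Sym2.map (SimpleGraph.pastingInl (G₁.subgraphOfAdj h₁) (G₂.subgraphOfAdj h₂) ψ)
    let ι₂ := Sym2.map (SimpleGraph.pastingInr (G₁.subgraphOfAdj h₁) (G₂.subgraphOfAdj h₂) ψ)
    let C₁ : Set (Sym2 V₁) := G₁.thetaClass ⟨s(a₁, b₁), h₁⟩
    let C₂ : Set (Sym2 V₂) := G₂.thetaClass ⟨s(a₂, b₂), h₂⟩
    -- `G` is a partial cube, and the isometric dimensions are finite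
    G.IsPartialCube ∧
    G₁.isometricDim ≠ ⊤ ∧ G₂.isometricDim ≠ ⊤ ∧ G.isometricDim ≠ ⊤ ∧
    -- the dimension formula, without truncated subtraction
    G.isometricDim + 1 = G₁.isometricDim + G₂.isometricDim ∧
    -- the relations `θ` are equivalence relations, so that their classes partition the edges
    Equivalence G₁.theta ∧ Equivalence G₂.theta ∧ Equivalence G.theta ∧
    -- the classes of `G`
    G.thetaClasses =
      (Set.image ι₁ '' (G₁.thetaClasses \ {C₁})) ∪
      (Set.image ι₂ '' (G₂.thetaClasses \ {C₂})) ∪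
      {ι₁ '' C₁ ∪ ι₂ '' C₂} := by
  intro G ι₁ ι₂ C₁ C₂
  obtain ⟨α, β, hαβ, hP⟩ := SimpleGraph.isEdgePasting_pasting h₁ h₂ ψ
  obtain ⟨hG, hcard, hclasses⟩ := hP.isPartialCube_and_thetaClasses hG₁ hG₂
  -- The class of an edge does not depend on the order in which its ends are named.
  have hC₂ : G₂.thetaClass ⟨s(α, β), hP.adj₂⟩ = C₂ := congrArg G₂.thetaClass (Subtype.ext hαβ)
  rw [hC₂] at hclasses
  have hdim : G.isometricDim + 1 = G₁.isometricDim + G₂.isometricDim := by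
    rw [hG.isometricDim_eq, hG₁.isometricDim_eq, hG₂.isometricDim_eq]
    exact hcard
  have hfin₁ := SimpleGraph.isometricDim_ne_top hG₁
  have hfin₂ := SimpleGraph.isometricDim_ne_top hG₂
  refine ⟨hG, hfin₁, hfin₂, fun htop => ?_, hdim, hG₁.equivalence_theta, hG₂.equivalence_theta,
    hG.equivalence_theta, hclasses⟩
  rw [htop, top_add] at hdim
  exact (WithTop.add_ne_top.2 ⟨hfin₁, hfin₂⟩) hdim.symm
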